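/- Let $G$ be a (Hausdorff, second countable) Lie group of dimension $n$ with a smooth Riemannian metric, and let $M$ be a homogeneous space of $G$ of dimension $m$, i.e. a smooth manifold with a smooth transitive action of $G$. Fix $o\in M$ with stabilizer $K$, so that $M\cong G/K$, and let $\pi:G\to M$, $\pi(a)=a\cdot o$, be the projection. For $z\in M$ let $\mathrm{Vol}_{\pi^{-1}(z)}$ be the Riemannian volume of the fiber $\pi^{-1}(z)$, a submanifold of $G$ of dimension $n-m$ with the induced metric, and let $\mathrm{Vol}_G$ be the Riemannian volume of $G$. Assume that the horizontal volume of $G$ induces a volume measure $\mathrm{Vol}_M$ on $M$: for a chart of $M$ around $z$ with coordinate vectors $\partial_1,\dots,\partial_m$, and horizontal lifts $h_i\in(\ker d\pi_y)^\perp$, $d\pi_y h_i=\partial_i$, at $y\in\pi^{-1}(z)$, the number $\sqrt{\det(\langle h_i,h_j\rangle)}$ does not depend on the choice of $y\in\pi^{-1}(z)$; $\mathrm{Vol}_M$ is the measure with this density in each chart. Assume also that $d\mathrm{Vol}_G=d\mathrm{Vol}_{\pi^{-1}(z)}\,d\mathrm{Vol}_M(z)$, i.e. for every Borel $f:G\to[0,\infty]$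 the function $z\mapsto\int_{\pi^{-1}(z)}f\,d\mathrm{Vol}_{\pi^{-1}(z)}$ is Borel and $$\int_G f\,d\mathrm{Vol}_G=\int_M\int_{\pi^{-1}(z)}f(y)\,d\mathrm{Vol}_{\pi^{-1}(z)}(y)\,d\mathrm{Vol}_M(z).$$ Let $X$ be a diffusion on $G$ (an adapted Markov process with almost surely continuous paths, with respect to a filtration $(\mathcal F_t)$) started at $x_0\in G$, whose transition function has a density $p^G_t(x,y)$ with respect to $\mathrm{Vol}_G$ for $t>0$, and put $\hat X=\pi(X)$, $\hat x_0=\pi(x_0)$. For $x\in G$, $t>0$ and $z\in M$ put $$p_t^G(x,\pi^{-1}(z))=\int_{\pi^{-1}(z)}p_t^G(x,y)\,d\mathrm{Vol}_{\pi^{-1}(z)}(y).$$ Then $\hat X$ is an adapted process in $M$ with almost surely continuous paths, started at $\hat x_0$, and for every $T>0$ the density $p_T^G(x_0,\cdot)$ pushes forward to the transition density $p^M_T(\hat x_0,z)=p_T^G(x_0,\pi^{-1}(z))$ of $\hat X$ on $M$. That is: 1. $z\mapsto p_T^G(x_0,\pi^{-1}(z))$ is Borel, finite $\mathrm{Vol}_M$-almost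 everywhere, and has integral $1$ with respect to $\mathrm{Vol}_M$; 2. $\pi_*\bigl(p_T^G(x_0,\cdot)\,\mathrm{Vol}_G\bigr)=p_T^G(x_0,\pi^{-1}(\cdot))\,\mathrm{Vol}_M$, and this measure is the law of $\hat X_T$; 3. for every $s\ge 0$ and every Borel set $B\subseteq M$, $\;\mathbb P(\hat X_{s+T}\in B\mid\mathcal F_s)=\int_B p_T^G(X_s,\pi^{-1}(z))\,d\mathrm{Vol}_M(z)$ almost surely; 4. whenever $\hat X$ is itself a diffusion on $M$ (with respect to some filtration) with transition function $(\kappa_t)$, then $\kappa_T(\hat x_0,dz)=p_T^G(x_0,\pi^{-1}(z))\,d\mathrm{Vol}_M(z)$. -/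

import Mathlib

open Set MeasureTheory ProbabilityTheory
open scoped Manifold ContDiff NNReal ENNReal

noncomputable section

/-! ### Riemannian volumes of a manifold and of its submanifolds -/

/-- The smooth Riemannian metrics on the `n`-dimensional manifold `G`. -/
abbrev SmoothMetric (n : ℕ) (G : Type*) [TopologicalSpace G]
    [ChartedSpace (EuclideanSpace ℝ (Fin n)) G] [IsManifold (𝓡 n) ∞ G] :=
  Bundle.ContMDiffRiemannianMetric (𝓡 n) ∞ (EuclideanSpace ℝ (Fin n))
    (fun x : G => TangentSpace (𝓡 n) x)

section Volume

variable {n : ℕ} {G : Type*} [TopologicalSpace G]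
  [ChartedSpace (EuclideanSpace ℝ (Fin n)) G] [IsManifold (𝓡 n) ∞ G]

/-- The volume `√ det (⟨v_i, v_j⟩)` spanned by tangent vectors `v_1, …, v_k` at `x`. -/
def gramVolume (g : SmoothMetric n G) (x : G) {k : ℕ}
    (v : Fin k → TangentSpace (𝓡 n) x) : ℝ≥0∞ :=
  ENNReal.ofReal (Real.sqrt (Matrix.det (Matrix.of fun i j => g.inner x (v i) (v j))))

/-- `ψ`, on the open set `U ⊆ ℝᵏ`, is a smooth injective immersion into `G` with values in `N`.
If `N` is an embedded `k`-dimensional submanifold, this is a local parametrization of an open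
part of `N`. -/
structure IsLocalParam (n : ℕ) {G : Type*} [TopologicalSpace G]
    [ChartedSpace (EuclideanSpace ℝ (Fin n)) G] {k : ℕ} (N : Set G) (U : Set (EuclideanSpace ℝ (Fin k)))
    (ψ : EuclideanSpace ℝ (Fin k) → G) : Prop where
  isOpen : IsOpen U
  smooth : ContMDiffOn (𝓡 k) (𝓡 n) ∞ ψ U
  injOn : InjOn ψ U
  immersion : ∀ u ∈ U, Function.Injective (mfderiv (𝓡 k) (𝓡 n) ψ u)
  mapsTo : MapsTo ψ U N

/-- The coordinate expression `√ det (⟨∂_i ψ, ∂_j ψ⟩)` of the induced volume at `u`. -/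
def paramDensity (g : SmoothMetric n G) {k : ℕ}
    (ψ : EuclideanSpace ℝ (Fin k) → G) (u : EuclideanSpace ℝ (Fin k)) : ℝ≥0∞ :=
  gramVolume g (ψ u) fun i : Fin k =>
    mfderiv (𝓡 k) (𝓡 n) ψ u (EuclideanSpace.single i (1 : ℝ) : EuclideanSpace ℝ (Fin k))

/-- The Riemannian volume measure `Vol_N` of the `k`-dimensional embedded submanifold `N` of `G`
with the induced metric, as a measure on `G` carried by `N`: the measure which on the image of
each local parametrization `ψ` is `√ det (⟨∂_i ψ, ∂_j ψ⟩) du`. These local measures agree on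
overlaps, so that gluing them amounts to taking their supremum in the lattice of measures. For
`k = 0` it is the counting measure on `N`. -/
def submanifoldVolume [MeasurableSpace G] (g : SmoothMetric n G) (k : ℕ) (N : Set G) :
    Measure G :=
  ⨆ (U : Set (EuclideanSpace ℝ (Fin k))) (ψ : EuclideanSpace ℝ (Fin k) → G)
    (_ : IsLocalParam n N U ψ), ((volume.restrict U).withDensity (paramDensity g ψ)).map ψ

/-- The Riemannian volume measure `Vol_G` of `G`. -/
def riemannianVolume [MeasurableSpace G] (g : SmoothMetric n G) : Measure G :=
  submanifoldVolume g n univ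

/-! ### The horizontal volume of a submersion -/

variable {m : ℕ} {M : Type*} [TopologicalSpace M]
  [ChartedSpace (EuclideanSpace ℝ (Fin m)) M]

/-- `h_1, …, h_m` are the horizontal lifts to `T_y G` of the coordinate vectors of the chart `φ`
of `M` at `π y`: they are orthogonal to the fiber (that is, to `ker d(φ ∘ π)`) and
`d(φ ∘ π) h_i = e_i`. -/
structure IsHorizontalFrame (g : SmoothMetric n G) (π : G → M)
    (φ : OpenPartialHomeomorph M (EuclideanSpace ℝ (Fin m))) (y : G)
    (h : Fin m → TangentSpace (𝓡 n) y) : Prop where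
  lift : ∀ i, mfderiv (𝓡 n) (𝓡 m) (fun y' => φ (π y')) y (h i) =
    (EuclideanSpace.single i (1 : ℝ) : EuclideanSpace ℝ (Fin m))
  horizontal : ∀ i (v : TangentSpace (𝓡 n) y),
    mfderiv (𝓡 n) (𝓡 m) (fun y' => φ (π y')) y v = 0 → g.inner y (h i) v = 0

/-- The horizontal part of the Riemannian volume of `G` induces a volume on `M`: the volume
`√ det (⟨h_i, h_j⟩)` of the horizontal lifts of a coordinate frame depends only on the point of
`M`, and not on the point of the fiber above it. (This holds for instance if `π` is a Riemannian
submersion for some metric on `M`.) -/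
def InducesVolume (g : SmoothMetric n G) (π : G → M) : Prop :=
  ∀ φ ∈ IsManifold.maximalAtlas (𝓡 m) ∞ M, ∀ y y' : G, π y ∈ φ.source → π y' = π y →
    ∀ h h', IsHorizontalFrame g π φ y h → IsHorizontalFrame g π φ y' h' →
      gramVolume g y h = gramVolume g y' h'

/-- The density in the chart `φ` of the volume induced on `M`: the volume of the horizontal lifts
of the coordinate vectors at `φ⁻¹ x`, taken at any point of the fiber above `φ⁻¹ x`. (Under
`InducesVolume` all members of the supremum are equal.) -/
def horizontalDensity (g : SmoothMetric n G) (π : G → M)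
    (φ : OpenPartialHomeomorph M (EuclideanSpace ℝ (Fin m)))
    (x : EuclideanSpace ℝ (Fin m)) : ℝ≥0∞ :=
  ⨆ (y : G) (_ : π y = φ.symm x) (h : Fin m → TangentSpace (𝓡 n) y)
    (_ : IsHorizontalFrame g π φ y h), gramVolume g y h

/-- The volume measure `Vol_M` induced on `M` by the horizontal volume of `G`: the measure which on
the domain of each chart of `M` has the above density. -/
def inducedVolume [MeasurableSpace M] (g : SmoothMetric n G) (π : G → M) : Measure M :=
  ⨆ (φ : OpenPartialHomeomorph M (EuclideanSpace ℝ (Fin m)))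
    (_ : φ ∈ IsManifold.maximalAtlas (𝓡 m) ∞ M),
    ((volume.restrict φ.target).withDensity (horizontalDensity g π φ)).map φ.symm

/-- The volume measure of the fiber `π⁻¹(z)`, a submanifold of dimension `n - m`, as a measure on
`G`. -/
def fiberVolume [MeasurableSpace G] (m : ℕ) {M : Type*} (g : SmoothMetric n G) (π : G → M)
    (z : M) : Measure G :=
  submanifoldVolume g (n - m) (π ⁻¹' {z})

/-- The decomposition `dVol_G = dVol_{π⁻¹(z)} dVol_M(z)` of the volume of `G` into the volume of
the fibers and the horizontal volume. -/
def VolumeDecomposes [MeasurableSpace G] [MeasurableSpace M] (g : SmoothMetric n G)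
    (π : G → M) : Prop :=
  ∀ f : G → ℝ≥0∞, Measurable f →
    Measurable (fun z : M => ∫⁻ y, f y ∂(fiberVolume m g π z)) ∧
    ∫⁻ y, f y ∂(riemannianVolume g) =
      ∫⁻ z, ∫⁻ y, f y ∂(fiberVolume m g π z) ∂(inducedVolume (m := m) g π)

/-- The function `z ↦ ∫_{π⁻¹(z)} q dVol_{π⁻¹(z)}` on `M`. -/
def fiberIntegral [MeasurableSpace G] (m : ℕ) {M : Type*} (g : SmoothMetric n G) (π : G → M)
    (q : G → ℝ≥0) (z : M) : ℝ≥0∞ :=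
  ∫⁻ y, (q y : ℝ≥0∞) ∂(fiberVolume m g π z)

end Volume

/-! ### Diffusions and their transition densities -/

section Diffusion

variable {S : Type*} [MeasurableSpace S]

/-- A (conservative, time-homogeneous) Markov transition function on `S`. -/
structure IsTransitionFunction (κ : ℝ≥0 → Kernel S S) : Prop where
  markov : ∀ t, IsMarkovKernel (κ t)
  zero : κ 0 = Kernel.id
  chapman_kolmogorov : ∀ (s t : ℝ≥0) (x : S) (B : Set S), MeasurableSet B →
    κ (s + t) x B = ∫⁻ y, κ t y B ∂(κ s x)

/-- `p` is the transition density of the transition function `κ` with respect to `vol`: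
`κ_t(x, dy) = p_t(x, y) vol(dy)` for `t > 0`. -/
def IsTransitionDensity (vol : Measure S) (κ : ℝ≥0 → Kernel S S)
    (p : ℝ≥0 → S → S → ℝ≥0) : Prop :=
  ∀ t, 0 < t → ∀ x, Measurable (p t x) ∧
    κ t x = vol.withDensity fun y => (p t x y : ℝ≥0∞)

/-- `X` is a diffusion process in `S` with transition function `κ`, started at `x₀`: an adapted
Markov process with continuous paths. -/
structure IsDiffusion [TopologicalSpace S] {Ω : Type*} [mΩ : MeasurableSpace Ω] (P : Measure Ω)
    (𝓕 : Filtration ℝ≥0 mΩ) (κ : ℝ≥0 → Kernel S S) (x₀ : S) (X : ℝ≥0 → Ω → S) : Prop where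
  transition : IsTransitionFunction κ
  adapted : ∀ t, Measurable[𝓕 t] (X t)
  continuous : ∀ᵐ w ∂P, Continuous fun t => X t w
  initial : ∀ᵐ w ∂P, X 0 w = x₀
  markov : ∀ (s t : ℝ≥0) (B : Set S), MeasurableSet B →
    P[(X (s + t) ⁻¹' B).indicator (fun _ => (1 : ℝ)) | 𝓕 s] =ᵐ[P]
      fun w => (κ t (X s w) B).toReal

end Diffusion

end

/-! The transition density comes from disintegration. Each fiber volume is carried by its fiber, on
which the indicator of `π ⁻¹' B` is constant. Inserting this indicator times a density `q` into the
decomposition of the volume therefore shows that `q` pushes forward to its fiber integral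
(`VolumeDecomposes.map_withDensity`). Applied to `p T x` for every starting point `x`, this
identifies the image of `κ T x` under `π`. The probabilistic claims follow from the Markov property
of `X` on sets `π ⁻¹' B`, and from the fact that a diffusion has law `κ t x₀` at time `t`
(`IsDiffusion.map_eq`). -/

section Volume

variable {n : ℕ} {G : Type*} [TopologicalSpace G]
  [ChartedSpace (EuclideanSpace ℝ (Fin n)) G] [IsManifold (𝓡 n) ∞ G]

/-- The volume of a submanifold is carried by the submanifold. -/
theorem submanifoldVolume_compl [MeasurableSpace G] (g : SmoothMetric n G) (k : ℕ) {N : Set G}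
    (hN : MeasurableSet N) : submanifoldVolume g k N Nᶜ = 0 := by
  -- A supremum of measures is not computed set by set, so vanishing on `Nᶜ` is recast as an upper
  -- bound, which can be checked on each member of the family.
  have hle : submanifoldVolume g k N ≤ (submanifoldVolume g k N).restrict N := by
    conv_lhs => unfold submanifoldVolume
    refine iSup_le fun U => iSup_le fun ψ => iSup_le fun h => ?_
    set ν : Measure G := ((volume.restrict U).withDensity (paramDensity g ψ)).map ψ with hν
    have hνle : ν ≤ submanifoldVolume g k N :=
      le_iSup_of_le U (le_iSup_of_le ψ (le_iSup_of_le h le_rfl))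
    have hnull : ν Nᶜ = 0 := by
      by_cases hψ : AEMeasurable ψ ((volume.restrict U).withDensity (paramDensity g ψ))
      · rw [hν, Measure.map_apply_of_aemeasurable hψ hN.compl]
        refine withDensity_absolutelyContinuous _ _ ?_
        refine measure_mono_null (t := Uᶜ) (fun u hu hU => hu (h.mapsTo hU)) ?_
        rw [Measure.restrict_apply h.isOpen.measurableSet.compl, compl_inter_self, measure_empty]
      -- The push-forward along a map that is not a.e. measurable is zero by convention.
      · rw [hν, Measure.map_of_not_aemeasurable hψ, Measure.coe_zero, Pi.zero_apply]
    calc ν = ν.restrict N := (Measure.restrict_eq_self_of_ae_mem (mem_ae_iff.2 hnull)).symm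
      _ ≤ _ := Measure.restrict_mono_measure hνle N
  refine le_antisymm ((hle _).trans ?_) zero_le
  rw [Measure.restrict_apply hN.compl, compl_inter_self, measure_empty]

variable {m : ℕ} {M : Type*}

theorem fiberVolume_ae_eq [MeasurableSpace G] [MeasurableSpace M] [MeasurableSingletonClass M]
    (g : SmoothMetric n G) {π : G → M} (hπ : Measurable π) (z : M) :
    ∀ᵐ y ∂(fiberVolume m g π z), π y = z :=
  mem_ae_iff.2 (submanifoldVolume_compl g (n - m) (hπ (measurableSet_singleton z)))

/-- Under the decomposition of the volume, densities push forward to their fiber integrals. -/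
theorem VolumeDecomposes.map_withDensity [TopologicalSpace M]
    [ChartedSpace (EuclideanSpace ℝ (Fin m)) M] [MeasurableSpace G] [MeasurableSpace M]
    [MeasurableSingletonClass M] {g : SmoothMetric n G} {π : G → M}
    (hdec : VolumeDecomposes (m := m) g π) (hπ : Measurable π) {q : G → ℝ≥0}
    (hq : Measurable q) :
    ((riemannianVolume g).withDensity fun y => (q y : ℝ≥0∞)).map π =
      (inducedVolume (m := m) g π).withDensity (fiberIntegral m g π q) := by
  ext B hB
  have hf : Measurable ((π ⁻¹' B).indicator fun y => (q y : ℝ≥0∞)) :=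
    hq.coe_nnreal_ennreal.indicator (hπ hB)
  rw [Measure.map_apply hπ hB, withDensity_apply _ (hπ hB), withDensity_apply _ hB,
    ← lintegral_indicator (hπ hB), (hdec _ hf).2, ← lintegral_indicator hB]
  refine lintegral_congr fun z => ?_
  have hfib : ∀ᵐ y ∂(fiberVolume m g π z), (π ⁻¹' B).indicator (fun y => (q y : ℝ≥0∞)) y =
      B.indicator (fun _ => (q y : ℝ≥0∞)) z := by
    filter_upwards [fiberVolume_ae_eq (m := m) g hπ z] with y hy
    subst hy
    rfl
  rw [lintegral_congr_ae hfib]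
  by_cases hz : z ∈ B <;> simp [hz, fiberIntegral]

end Volume

/-- The law at time `t` of a diffusion started at `x₀` is `κ t x₀`. -/
theorem IsDiffusion.map_eq {S : Type*} [MeasurableSpace S] [TopologicalSpace S] {Ω : Type*}
    [mΩ : MeasurableSpace Ω] {P : Measure Ω} [IsProbabilityMeasure P] {𝓕 : Filtration ℝ≥0 mΩ}
    {κ : ℝ≥0 → Kernel S S} {x₀ : S} {X : ℝ≥0 → Ω → S} (hX : IsDiffusion P 𝓕 κ x₀ X) (t : ℝ≥0) :
    P.map (X t) = κ t x₀ := by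
  have := hX.transition.markov t
  have hXt : Measurable (X t) := (hX.adapted t).mono (𝓕.le t) le_rfl
  ext B hB
  -- At `s = 0` the conditional probability is a.s. the constant `κ t x₀ B`, because `X 0 = x₀`
  -- a.s.; integrating it gives the law.
  have hint : ∫ w, (X (0 + t) ⁻¹' B).indicator (fun _ => (1 : ℝ)) w ∂P =
      ∫ _, (κ t x₀ B).toReal ∂P := by
    rw [← integral_condExp (𝓕.le 0)]
    refine integral_congr_ae ?_
    filter_upwards [hX.markov 0 t B hB, hX.initial] with w hw h0
    rw [hw, h0]
  rw [zero_add, integral_indicator_const _ (hXt hB), integral_const, probReal_univ, one_smul,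
    smul_eq_mul, mul_one, Measure.real,
    ENNReal.toReal_eq_toReal_iff' (measure_ne_top _ _) (measure_ne_top _ _)] at hint
  rw [Measure.map_apply hXt hB, hint]

theorem theorem3 {n m : ℕ}
    -- the Lie group `G` with a Riemannian metric `g`
    {G : Type*} [TopologicalSpace G] [ChartedSpace (EuclideanSpace ℝ (Fin n)) G] [Group G]
    [LieGroup (𝓡 n) ∞ G] [T2Space G] [SecondCountableTopology G]
    [MeasurableSpace G] [BorelSpace G]
    (g : SmoothMetric n G)
    -- the homogeneous space `M ≅ G / K`, where `K` is the stabilizer of the point `o`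
    {M : Type*} [TopologicalSpace M] [ChartedSpace (EuclideanSpace ℝ (Fin m)) M]
    [IsManifold (𝓡 m) ∞ M] [T2Space M] [SecondCountableTopology M]
    [MeasurableSpace M] [BorelSpace M]
    [MulAction G M] [ContMDiffSMul (𝓡 n) (𝓡 m) ∞ G M] [MulAction.IsPretransitive G M]
    (o : M) (π : G → M) (hπ : ∀ a : G, π a = a • o)
    -- `M` carries the induced volume, and the volume of `G` decomposes
    (hind : InducesVolume (m := m) g π) (hdec : VolumeDecomposes (m := m) g π)
    -- the diffusion `X` on `G` started at `x₀`, with transition density `p`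
    {Ω : Type*} [mΩ : MeasurableSpace Ω] (P : Measure Ω) [IsProbabilityMeasure P]
    (𝓕 : Filtration ℝ≥0 mΩ) (κ : ℝ≥0 → Kernel G G) (p : ℝ≥0 → G → G → ℝ≥0)
    (hp : IsTransitionDensity (riemannianVolume g) κ p)
    (x₀ : G) (X : ℝ≥0 → Ω → G) (hX : IsDiffusion P 𝓕 κ x₀ X) :
    -- `π(X)` is an adapted continuous process in `M` started at `π(x₀)`
    ((∀ t, Measurable[𝓕 t] fun w => π (X t w)) ∧
      (∀ᵐ w ∂P, Continuous fun t => π (X t w)) ∧ (∀ᵐ w ∂P, π (X 0 w) = π x₀)) ∧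
    ∀ T : ℝ≥0, 0 < T →
      -- `z ↦ ∫_{π⁻¹(z)} p_T(x₀, y) dVol(y)` is a probability density with respect to `Vol_M`
      Measurable (fiberIntegral m g π (p T x₀)) ∧
      (∀ᵐ z ∂(inducedVolume (m := m) g π), fiberIntegral m g π (p T x₀) z < ⊤) ∧
      ∫⁻ z, fiberIntegral m g π (p T x₀) z ∂(inducedVolume (m := m) g π) = 1 ∧
      -- it is the push-forward of `p_T(x₀, ·)` under `π`
      ((riemannianVolume g).withDensity fun y => (p T x₀ y : ℝ≥0∞)).map π =
        (inducedVolume (m := m) g π).withDensity (fiberIntegral m g π (p T x₀)) ∧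
      -- it is the density of `π(X_T)`
      P.map (fun w => π (X T w)) =
        (inducedVolume (m := m) g π).withDensity (fiberIntegral m g π (p T x₀)) ∧
      -- the conditional law of `π(X_{s+T})` given the past up to time `s` has the corresponding
      -- density started from `X_s`
      (∀ (s : ℝ≥0) (B : Set M), MeasurableSet B →
        P[((fun w => π (X (s + T) w)) ⁻¹' B).indicator (fun _ => (1 : ℝ)) | 𝓕 s] =ᵐ[P]
          fun w => (∫⁻ z in B, fiberIntegral m g π (p T (X s w)) z
            ∂(inducedVolume (m := m) g π)).toReal) ∧
      -- whenever `π(X)` is a diffusion on `M`, its transition function started from `π(x₀)` has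
      -- this density
      (∀ (𝓖 : Filtration ℝ≥0 mΩ) (κM : ℝ≥0 → Kernel M M),
        IsDiffusion P 𝓖 κM (π x₀) (fun t w => π (X t w)) →
        κM T (π x₀) =
          (inducedVolume (m := m) g π).withDensity (fiberIntegral m g π (p T x₀))) := by
  have hcont : Continuous π := by
    have : ContinuousSMul G M :=
      ContMDiffSMul.continuousSMul (I := 𝓡 n) (I' := 𝓡 m) ∞
    rw [funext hπ]
    exact continuous_id.smul continuous_const
  have hmeas : Measurable π := hcont.measurable
  refine ⟨⟨fun t => hmeas.comp (hX.adapted t), hX.continuous.mono fun w hw => hcont.comp hw,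
    hX.initial.mono fun w hw => congrArg π hw⟩, fun T hT => ?_⟩
  -- An arbitrary starting point is needed: the conditional law given `𝓕 s` starts from the random
  -- point `X s w`.
  have hpush (x : G) : (κ T x).map π =
      (inducedVolume (m := m) g π).withDensity (fiberIntegral m g π (p T x)) := by
    rw [(hp T hT x).2]
    exact hdec.map_withDensity hmeas (hp T hT x).1
  have hfib : Measurable (fiberIntegral m g π (p T x₀)) :=
    (hdec _ (hp T hT x₀).1.coe_nnreal_ennreal).1
  have hone : ∫⁻ z, fiberIntegral m g π (p T x₀) z ∂(inducedVolume (m := m) g π) = 1 := by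
    have := hX.transition.markov T
    rw [← setLIntegral_univ, ← withDensity_apply _ MeasurableSet.univ, ← hpush,
      Measure.map_apply hmeas MeasurableSet.univ, preimage_univ, measure_univ]
  have hlaw : P.map (fun w => π (X T w)) =
      (inducedVolume (m := m) g π).withDensity (fiberIntegral m g π (p T x₀)) := by
    rw [← hpush, ← hX.map_eq T, Measure.map_map hmeas ((hX.adapted T).mono (𝓕.le T) le_rfl)]
    rfl
  -- For the last claim, `κM T (π x₀)` and the density are both the law of `π (X T)`, whatever the
  -- filtration `𝓖`.
  refine ⟨hfib, ae_lt_top hfib (by simp [hone]), hone,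
    hdec.map_withDensity hmeas (hp T hT x₀).1, hlaw, fun s B hB => ?_,
    fun 𝓖 κM hM => (hM.map_eq T).symm.trans hlaw⟩
  -- With this identity the claim is the Markov property of `X` for the set `π ⁻¹' B`.
  have hκ (x : G) : κ T x (π ⁻¹' B) =
      ∫⁻ z in B, fiberIntegral m g π (p T x) z ∂(inducedVolume (m := m) g π) := by
    rw [← withDensity_apply _ hB, ← hpush, Measure.map_apply hmeas hB]
  simp only [← hκ]
  exact hX.markov s T (π ⁻¹' B) (hmeas hB)
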